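/- All graphs are finite, simple and undirected. For a graph $G=(V,E)$ and an integer $r\ge 0$, a set $D\subseteq V$ is a distance-$r$ dominating set if every vertex of $G$ is at distance at most $r$ from some vertex of $D$. An $r$-shallow minor of $G$ is a graph obtained by taking a subgraph $S$ of $G$, partitioning $V(S)$ into parts that induce connected subgraphs of $S$ of radius at most $r$, and contracting each part to a single vertex (removing loops and parallel edges); $\nabla_r(G)$ is the maximum edge density $|E(H)|/|V(H)|$ over all $r$-shallow minors $H$ of $G$. A graph class $\mathcal C$ has bounded expansion with expansion function $f:\mathbb N\to\mathbb N$ if $\nabla_s(G)\le f(s)$ for all $G\in\mathcal C$ and all $s\in\mathbb N$. The girth of a graph is the length of its shortest cycle ($\infty$ for forests). In the CONGEST model the vertices of an $n$-vertex graph $G$ are processors with distinct identifiers of $O(\log n)$ bits. Initially a vertex knows only its own identifier and those of its neighbours. In each synchronous round every vertex sends a message of $O(\log n)$ bits to each of its neighbours, receives the messages of its neighbours, performs arbitrary local computation, and may halt with an output. **Theorem.** There are deterministic CONGEST algorithms $A_r$ ($r\in\mathbb N$) and absolute constants $c,C$ such that the following holds for every $r\in\mathbb N$ and every graph class $\mathcal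 C$ of bounded expansion with expansion function $f$ in which every graph has girth at least $4r+3$. On every $G\in\mathcal C$, with any assignment of distinct identifiers of $O(\log n)$ bits, all vertices halt under $A_r$ within $c\cdot r$ rounds, all messages have $O(\log n)$ bits (where the implied constant depends only on the one for the identifiers), and the set $D$ of vertices that output "yes" is a distance-$r$ dominating set of $G$ with $$|D|\le \bigl(1+C\cdot r\cdot f(r)\bigr)\cdot |M|$$ for every minimum distance-$r$ dominating set $M$ of $G$. In particular, $A_r$ runs in $O(r)$ rounds and is an $O(r\cdot f(r))$-approximation whenever $r\cdot f(r)\ge 1$. -/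

import Mathlib

open scoped ENNReal

universe u

/-! ### Distance-`r` domination -/

/-- `D` is a distance-`r` dominating set of `G`: every vertex is at distance at most `r` from some
vertex of `D`. The distance `SimpleGraph.edist` is `⊤` between different components. -/
def IsDistDominating {V : Type u} (G : SimpleGraph V) (r : ℕ) (D : Finset V) : Prop :=
  ∀ v : V, ∃ d ∈ D, G.edist d v ≤ (r : ℕ∞)

/-- `D` is a distance-`r` dominating set whose size is at most `α` times the size of every
(in particular, of a minimum) distance-`r` dominating set. -/
def IsDistDominatingApprox {V : Type u} (G : SimpleGraph V) (r α : ℕ) (D : Finset V) : Prop :=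
  IsDistDominating G r D ∧ ∀ M : Finset V, IsDistDominating G r M → D.card ≤ α * M.card

/-! ### Shallow minors and expansion -/

/-- `H` is an `r`-shallow minor of `G`: there are a subgraph `S` of `G` and a partition of the
vertices of `S` (the fibres of `π`), each part inducing a connected subgraph of `S` of radius at
most `r`, such that `H` arises from `S` by contracting every part to a single vertex (loops and
parallel edges are removed). A part is never empty, as a connected graph has a vertex. -/
def IsShallowMinor {V : Type u} {W : Type*} (r : ℕ) (H : SimpleGraph W) (G : SimpleGraph V) :
    Prop :=
  ∃ (S : G.Subgraph) (π : S.verts → W),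
    (∀ w : W, (S.coe.induce {x | π x = w}).Connected ∧
      (S.coe.induce {x | π x = w}).radius ≤ (r : ℕ∞)) ∧
    ∀ w w' : W, H.Adj w w' ↔ w ≠ w' ∧ ∃ x y : S.verts, π x = w ∧ π y = w' ∧ S.coe.Adj x y

/-- The edge density `|E| / |V|` of a graph on `t` vertices (`0` if `t = 0`). -/
noncomputable def edgeDensity {t : ℕ} (H : SimpleGraph (Fin t)) : ℝ≥0∞ :=
  (H.edgeSet.ncard : ℝ≥0∞) / (t : ℝ≥0∞)

/-- `∇_r(G)`: the largest edge density of an `r`-shallow minor of `G`. Up to isomorphism the minors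
of a finite graph are graphs on `Fin t`. -/
noncomputable def nabla {V : Type u} (r : ℕ) (G : SimpleGraph V) : ℝ≥0∞ :=
  ⨆ (t : ℕ) (H : SimpleGraph (Fin t)) (_ : IsShallowMinor r H G), edgeDensity H

/-- A class of graphs; only its finite members are ever considered. -/
abbrev GraphClass := ∀ V : Type u, SimpleGraph V → Prop

/-- The class `C` has bounded expansion with expansion function `f`. -/
def GraphClass.HasExpansion (C : GraphClass.{u}) (f : ℕ → ℕ) : Prop :=
  ∀ (V : Type u) [Fintype V] (G : SimpleGraph V), C V G → ∀ s : ℕ, nabla s G ≤ (f s : ℝ≥0∞)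

/-- Every graph in the class `C` has girth at least `g` (forests have girth `⊤`). -/
def GraphClass.GirthAtLeast (C : GraphClass.{u}) (g : ℕ) : Prop :=
  ∀ (V : Type u) [Fintype V] (G : SimpleGraph V), C V G → (g : ℕ∞) ≤ G.egirth

/-! ### Synchronous message passing -/

/-- A deterministic distributed algorithm with a yes/no output at each vertex. Local computation
is arbitrary. A vertex starts with its own identifier and the identifiers of its neighbours, and
does not know the number of vertices. -/
structure DistributedAlgorithm where
  /-- the local memory of a vertex -/
  State : Type
  /-- initial state, from the own identifier and the set of the neighbours' identifiers -/
  init : ℕ → Finset ℕ → State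
  /-- the bit string sent to the neighbour with the given identifier -/
  send : State → ℕ → List Bool
  /-- the new state, from the set of pairs (identifier of a neighbour, message received from it) -/
  receive : State → Finset (ℕ × List Bool) → State
  /-- `some b` if the vertex has halted with output `b`, and `none` if it is still running -/
  output : State → Option Bool

namespace DistributedAlgorithm

variable (A : DistributedAlgorithm) {V : Type u} [Fintype V] (G : SimpleGraph V) (ident : V → ℕ)

/-- The message that a vertex in state `s` passes to the neighbour with identifier `i`; a vertex
that has halted only passes empty messages. -/
def outgoing (s : A.State) (i : ℕ) : List Bool :=
  if (A.output s).isSome then [] else A.send s i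

open Classical in
/-- The state of every vertex after `t` synchronous rounds on the network `G` with identifiers
`ident`. A vertex that has halted keeps its state. -/
noncomputable def state : ℕ → V → A.State
  | 0, v => A.init (ident v) ((Finset.univ.filter (fun u => G.Adj v u)).image ident)
  | t + 1, v =>
    if (A.output (state t v)).isSome then state t v
    else A.receive (state t v)
      ((Finset.univ.filter (fun u => G.Adj v u)).image
        (fun u => (ident u, A.outgoing (state t u) (ident v))))

/-- Every vertex has halted after at most `T` rounds. -/
def HaltsWithin (T : ℕ) : Prop :=
  ∀ v : V, (A.output (A.state G ident T v)).isSome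

/-- Every message ever sent along an edge has at most `B` bits. -/
def MessagesBoundedBy (B : ℕ) : Prop :=
  ∀ (t : ℕ) (u v : V), G.Adj u v → (A.outgoing (A.state G ident t u) (ident v)).length ≤ B

open Classical in
/-- The set of vertices that have halted with output "yes" after `T` rounds. -/
noncomputable def outputSet (T : ℕ) : Finset V :=
  Finset.univ.filter (fun v => A.output (A.state G ident T v) = some true)

end DistributedAlgorithm

/-- `ident` is an assignment of distinct identifiers of at most `a * (⌊log₂ n⌋ + 1)` bits, where
`n` is the number of vertices. -/
def IsIdentifierAssignment {V : Type u} [Fintype V] (a : ℕ) (ident : V → ℕ) : Prop :=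
  Function.Injective ident ∧ ∀ v : V, ident v < 2 ^ (a * (Nat.log 2 (Fintype.card V) + 1))

/-! ### Leaf pruning -/

section Pruning

variable {V : Type u} (G : SimpleGraph V)

/-! The algorithm strips leaves `r` times, keeping one end of an isolated edge. A removed vertex has
a neighbour that stays, so each step costs at most one in distance (`isDistDominating_survivors`).

For the size, split the graph into breadth-first trees of depth at most `r` rooted at a dominating
set `M`. Girth `4r + 3` excludes non-tree edges inside a part and a second edge between two parts.
Hence contracting the parts merges no cross edges, and the density of this `r`-shallow minor bounds
the ordered cross pairs by `2 f(r) |M|` (`card_crossPairs_le`). A branch that meets no cross edge is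
pruned from the bottom up in time, so a survivor outside `M` with a surviving neighbour is among the
first `r` vertices on the tree path from an end of a cross edge towards its root
(`exists_crossPair_of_mem_survivors`). Every other survivor is in `M` or isolated. An isolated one
is alone in its component, so the map to roots is injective on these, and there are at most `|M|` of
them. -/

open Classical in
/-- The neighbours of `v` in the vertex set `A`. -/
noncomputable def neighborsIn (A : Finset V) (v : V) : Finset V :=
  A.filter (fun u => G.Adj v u)

variable {G} in
theorem mem_neighborsIn {A : Finset V} {v u : V} :
    u ∈ neighborsIn G A v ↔ u ∈ A ∧ G.Adj v u := by
  simp [neighborsIn]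

variable {G} in
theorem neighborsIn_mono {A B : Finset V} (h : A ⊆ B) (v : V) :
    neighborsIn G A v ⊆ neighborsIn G B v := fun _ hu =>
  mem_neighborsIn.2 ⟨h (mem_neighborsIn.1 hu).1, (mem_neighborsIn.1 hu).2⟩

variable {G} in
theorem adj_of_neighborsIn_eq {A : Finset V} {v u : V} (h : neighborsIn G A v = {u}) :
    u ∈ A ∧ G.Adj v u :=
  mem_neighborsIn.1 (h ▸ Finset.mem_singleton_self u)

variable [Fintype V] (ident : V → ℕ)

open Classical in
/-- The vertices that survive `t` steps of leaf pruning. In each step the vertices with exactly one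
surviving neighbour are removed; of two vertices that are each other's only surviving neighbour,
the one with the larger identifier is kept. -/
noncomputable def survivors : ℕ → Finset V
  | 0 => Finset.univ
  | t + 1 => (survivors t).filter (fun v => ∀ u, neighborsIn G (survivors t) v = {u} →
      neighborsIn G (survivors t) u = {v} ∧ ident u < ident v)

variable {G ident}

theorem mem_survivors_succ {t : ℕ} {v : V} :
    v ∈ survivors G ident (t + 1) ↔ v ∈ survivors G ident t ∧
      ∀ u, neighborsIn G (survivors G ident t) v = {u} →
        neighborsIn G (survivors G ident t) u = {v} ∧ ident u < ident v := by
  simp [survivors]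

theorem survivors_anti : Antitone (survivors G ident) :=
  antitone_nat_of_succ_le fun _ _ hv => (mem_survivors_succ.1 hv).1

/-- A vertex removed in some step has exactly one surviving neighbour. -/
theorem exists_neighborsIn_eq_singleton {t : ℕ} {v : V} (hv : v ∈ survivors G ident t)
    (hv' : v ∉ survivors G ident (t + 1)) :
    ∃ u, neighborsIn G (survivors G ident t) v = {u} ∧
      ¬ (neighborsIn G (survivors G ident t) u = {v} ∧ ident u < ident v) := by
  by_contra! h
  exact hv' (mem_survivors_succ.2 ⟨hv, fun u hu => h u hu⟩)

/-- The only surviving neighbour of a vertex that is removed is not removed in the same step. -/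
theorem exists_adj_mem_survivors (hinj : Function.Injective ident) {t : ℕ} {v : V}
    (hv : v ∈ survivors G ident t) (hv' : v ∉ survivors G ident (t + 1)) :
    ∃ u ∈ survivors G ident (t + 1), G.Adj v u := by
  obtain ⟨u, hu, hn⟩ := exists_neighborsIn_eq_singleton hv hv'
  obtain ⟨huA, hadj⟩ := adj_of_neighborsIn_eq hu
  refine ⟨u, mem_survivors_succ.2 ⟨huA, fun w hw => ?_⟩, hadj⟩
  have hvw : v ∈ neighborsIn G (survivors G ident t) u := mem_neighborsIn.2 ⟨hv, hadj.symm⟩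
  rw [hw, Finset.mem_singleton] at hvw
  subst hvw
  -- Here `u` and `v` form an isolated edge. As `v` lost the tie, `u` wins it; injectivity makes the
  -- comparison strict.
  refine ⟨hu, lt_of_le_of_ne (not_lt.1 fun h => hn ⟨hw, h⟩) fun h => hadj.ne (hinj h)⟩

theorem isDistDominating_survivors (hinj : Function.Injective ident) (t : ℕ) :
    IsDistDominating G t (survivors G ident t) := by
  induction t with
  | zero => exact fun v => ⟨v, by simp [survivors], by simp⟩
  | succ t ih =>
    intro v
    obtain ⟨d, hd, hdv⟩ := ih v
    by_cases hd' : d ∈ survivors G ident (t + 1)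
    · exact ⟨d, hd', hdv.trans (by norm_cast; omega)⟩
    · obtain ⟨u, hu, hadj⟩ := exists_adj_mem_survivors hinj hd hd'
      refine ⟨u, hu, (SimpleGraph.edist_triangle (v := d)).trans ?_⟩
      rw [SimpleGraph.edist_eq_one_iff_adj.2 hadj.symm, add_comm]
      push_cast
      gcongr

/-- Pruning leaves does not disconnect: a set of survivors that is closed under adjacency among the
survivors is the trace of a union of components. -/
theorem exists_closed_inter_survivors (t : ℕ) (S : Set V) (hS : S ⊆ survivors G ident t)
    (hcl : ∀ x ∈ S, ∀ y ∈ survivors G ident t, G.Adj x y → y ∈ S) :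
    ∃ S' : Set V, (∀ x ∈ S', ∀ y, G.Adj x y → y ∈ S') ∧ S' ∩ survivors G ident t = S := by
  induction t generalizing S with
  | zero => exact ⟨S, fun x hx y h => hcl x hx y (by simp [survivors]) h, by
      simp [survivors]⟩
  | succ t ih =>
    have hsub := survivors_anti (G := G) (ident := ident) (Nat.le_succ t)
    -- Apply induction to `S` together with the leaves hanging from `S` that this step removed.
    obtain ⟨S', hS', hS''⟩ := ih (S ∪ {x | x ∈ survivors G ident t ∧
        x ∉ survivors G ident (t + 1) ∧ ∃ u ∈ S, neighborsIn G (survivors G ident t) x = {u}})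
      (by
        rintro x (hx | hx)
        · exact hsub (hS hx)
        · exact hx.1) (by
        rintro x (hx | ⟨hx, -, u, hu, hxu⟩) y hy hadj
        · by_cases hy' : y ∈ survivors G ident (t + 1)
          · exact Or.inl (hcl x hx y hy' hadj)
          · obtain ⟨u, hu, -⟩ := exists_neighborsIn_eq_singleton hy hy'
            have hxm : x ∈ neighborsIn G (survivors G ident t) y :=
              mem_neighborsIn.2 ⟨hsub (hS hx), hadj.symm⟩
            rw [hu, Finset.mem_singleton] at hxm
            exact Or.inr ⟨hy, hy', x, hx, hxm ▸ hu⟩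
        · have hym : y ∈ neighborsIn G (survivors G ident t) x := mem_neighborsIn.2 ⟨hy, hadj⟩
          rw [hxu, Finset.mem_singleton] at hym
          exact Or.inl (hym ▸ hu))
    refine ⟨S', hS', Set.ext fun x => ⟨fun ⟨hx, hx'⟩ => ?_, fun hx => ⟨?_, hS hx⟩⟩⟩
    · have : x ∈ S' ∩ survivors G ident t := ⟨hx, hsub hx'⟩
      rw [hS''] at this
      rcases this with h | h
      · exact h
      · exact absurd hx' h.2.1
    · have : x ∈ S' ∩ survivors G ident t := hS'' ▸ Or.inl hx
      exact this.1

/-- A survivor without surviving neighbours is the only survivor of its component. -/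
theorem eq_of_neighborsIn_eq_empty {t : ℕ} {v w : V} (hv : v ∈ survivors G ident t)
    (hiso : neighborsIn G (survivors G ident t) v = ∅) (hw : w ∈ survivors G ident t)
    (hvw : G.Reachable v w) : w = v := by
  obtain ⟨S, hS, hS'⟩ := exists_closed_inter_survivors (G := G) (ident := ident) t {v}
    (by simpa using hv) (by
      rintro x rfl y hy hadj
      exact absurd (mem_neighborsIn.2 ⟨hy, hadj⟩) (by simp [hiso]))
  have hvS : v ∈ S := by
    have : v ∈ S ∩ survivors G ident t := hS' ▸ rfl
    exact this.1
  have hwS : w ∈ S := by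
    obtain ⟨p⟩ := hvw
    clear hS' hiso hw hv
    induction p with
    | nil => exact hvS
    | cons h _ ih => exact ih (hS _ hvS _ h)
  have : w ∈ S ∩ survivors G ident t := ⟨hwS, hw⟩
  rwa [hS'] at this

end Pruning

/-! ### Forests of breadth-first search trees -/

/-- A partition of the graph into trees of depth at most `r` rooted at the vertices of `M`. -/
structure RootedPartition {V : Type u} (G : SimpleGraph V) (r : ℕ) (M : Finset V) where
  /-- the distance from the root -/
  depth : V → ℕ
  /-- the parent of a vertex that is not a root -/
  parent : V → V
  /-- the root of the part of a vertex -/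
  root : V → V
  depth_le : ∀ v, depth v ≤ r
  root_mem : ∀ v, root v ∈ M
  root_eq : ∀ v ∈ M, root v = v
  adj_parent : ∀ v ∉ M, G.Adj v (parent v)
  root_parent : ∀ v ∉ M, root (parent v) = root v
  depth_parent : ∀ v ∉ M, depth (parent v) + 1 = depth v
  depth_root : ∀ v ∈ M, depth v = 0

theorem IsDistDominating.nonempty_rootedPartition {V : Type u} {G : SimpleGraph V} {r : ℕ}
    {M : Finset V} (hM : IsDistDominating G r M) : Nonempty (RootedPartition G r M) := by
  classical
  have hex : ∀ v, ∃ n, ∃ m ∈ M, ∃ p : G.Walk v m, p.length = n := by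
    intro v
    obtain ⟨m, hm, hd⟩ := hM v
    have hne : G.edist m v ≠ ⊤ := ne_top_of_le_ne_top (ENat.natCast_ne_top r) hd
    obtain ⟨p, -⟩ := SimpleGraph.exists_walk_of_edist_ne_top hne
    exact ⟨_, m, hm, p.reverse, rfl⟩
  let depth : V → ℕ := fun v => Nat.find (hex v)
  have hle : ∀ {v m : V} (p : G.Walk v m), m ∈ M → depth v ≤ p.length :=
    fun {v m} p hm => Nat.find_min' (hex v) ⟨m, hm, p, rfl⟩
  have hzero : ∀ v ∈ M, depth v = 0 := fun v hv =>
    Nat.le_zero.1 (hle (SimpleGraph.Walk.nil : G.Walk v v) hv)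
  have hpar : ∀ v, ∃ u, v ∉ M → G.Adj v u ∧ depth u + 1 = depth v := by
    intro v
    by_cases hv : v ∈ M
    · exact ⟨v, fun h => absurd hv h⟩
    obtain ⟨m, hm, p, hp⟩ := Nat.find_spec (hex v)
    change p.length = depth v at hp
    cases p with
    | nil => exact absurd hm hv
    | @cons _ u _ h q =>
      refine ⟨u, fun _ => ⟨h, ?_⟩⟩
      have h1 := hle q hm
      obtain ⟨m', hm', q', hq'⟩ := Nat.find_spec (hex u)
      change q'.length = depth u at hq'
      have h2 := hle (SimpleGraph.Walk.cons h q') hm'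
      simp only [SimpleGraph.Walk.length_cons] at hp h2
      omega
  choose parent hparent using hpar
  have hroot : ∀ n v, depth v = n → parent^[n] v ∈ M := by
    intro n
    induction n with
    | zero =>
      intro v hv
      obtain ⟨m, hm, p, hp⟩ := Nat.find_spec (hex v)
      change p.length = depth v at hp
      rw [hv] at hp
      rw [Function.iterate_zero, id, SimpleGraph.Walk.eq_of_length_eq_zero hp]
      exact hm
    | succ n ih =>
      intro v hv
      have hvM : v ∉ M := fun h => by simp [hzero v h] at hv
      exact ih (parent v) (by have := (hparent v hvM).2; omega)
  exact ⟨{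
    depth := depth
    parent := parent
    root := fun v => parent^[depth v] v
    depth_le := by
      intro v
      obtain ⟨m, hm, hd⟩ := hM v
      have hne : G.edist m v ≠ ⊤ := ne_top_of_le_ne_top (ENat.natCast_ne_top r) hd
      obtain ⟨p, hp⟩ := SimpleGraph.exists_walk_of_edist_ne_top hne
      rw [← hp] at hd
      have := hle p.reverse hm
      rw [SimpleGraph.Walk.length_reverse] at this
      exact this.trans (by exact_mod_cast hd)
    root_mem := fun v => hroot _ v rfl
    root_eq := fun v hv => by simp [hzero v hv]
    adj_parent := fun v hv => (hparent v hv).1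
    root_parent := fun v hv => by
      rw [← (hparent v hv).2, Function.iterate_succ_apply]
    depth_parent := fun v hv => (hparent v hv).2
    depth_root := hzero }⟩

/-- An edge whose ends are joined by a walk of length `n` avoiding it lies on a cycle of length at
most `n + 1`. -/
theorem SimpleGraph.Adj.egirth_le {V : Type u} {G : SimpleGraph V} {x y : V} (h : G.Adj x y)
    (p : G.Walk y x) (hp : s(x, y) ∉ p.edges) : G.egirth ≤ (p.length + 1 : ℕ) := by
  classical
  have hc := SimpleGraph.Path.cons_isCycle (⟨p.bypass, p.bypass_isPath⟩ : G.Path y x) h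
    (fun he => hp (p.edges_bypass_subset_edges he))
  refine (SimpleGraph.egirth_le_length hc).trans ?_
  rw [SimpleGraph.Walk.length_cons]
  exact_mod_cast Nat.succ_le_succ p.length_bypass_le_length

/-! ### Tree paths and the effect of large girth -/

namespace RootedPartition

variable {V : Type u} {G : SimpleGraph V} {r : ℕ} {M : Finset V} (P : RootedPartition G r M)

/-- Recording that the walk uses tree edges only ensures that it avoids any given non-tree edge, as
closing a cycle requires. -/
theorem exists_walk_root (v : V) : ∃ p : G.Walk v (P.root v), p.length ≤ r ∧
    ∀ e ∈ p.edges, ∃ z ∉ M, e = s(z, P.parent z) := by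
  suffices h : ∀ n v, P.depth v = n → ∃ p : G.Walk v (P.root v), p.length ≤ n ∧
      ∀ e ∈ p.edges, ∃ z ∉ M, e = s(z, P.parent z) by
    obtain ⟨p, hp, h'⟩ := h _ v rfl
    exact ⟨p, hp.trans (P.depth_le v), h'⟩
  intro n
  induction n with
  | zero =>
    intro v hv
    have hvM : v ∈ M := by
      by_contra h
      have := P.depth_parent v h
      omega
    refine ⟨SimpleGraph.Walk.nil.copy rfl (P.root_eq v hvM).symm, by simp, by simp⟩
  | succ n ih =>
    intro v hv
    have hvM : v ∉ M := fun h => by simp [P.depth_root v h] at hv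
    obtain ⟨p, hp, hpe⟩ := ih (P.parent v) (by have := P.depth_parent v hvM; omega)
    refine ⟨(SimpleGraph.Walk.cons (P.adj_parent v hvM) p).copy rfl (P.root_parent v hvM),
      by simpa using hp, ?_⟩
    intro e he
    simp only [SimpleGraph.Walk.edges_copy, SimpleGraph.Walk.edges_cons, List.mem_cons] at he
    rcases he with rfl | he
    · exact ⟨v, hvM, rfl⟩
    · exact hpe e he

theorem exists_walk_of_root_eq {x y : V} (h : P.root x = P.root y) :
    ∃ p : G.Walk x y, p.length ≤ 2 * r ∧ ∀ e ∈ p.edges, ∃ z ∉ M, e = s(z, P.parent z) := by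
  obtain ⟨p, hp, hpe⟩ := P.exists_walk_root x
  obtain ⟨q, hq, hqe⟩ := P.exists_walk_root y
  refine ⟨p.append (q.reverse.copy h.symm rfl), ?_, fun e he => ?_⟩
  · simp only [SimpleGraph.Walk.length_append, SimpleGraph.Walk.length_copy,
      SimpleGraph.Walk.length_reverse]
    omega
  · simp only [SimpleGraph.Walk.edges_append, SimpleGraph.Walk.edges_copy,
      SimpleGraph.Walk.edges_reverse, List.mem_append, List.mem_reverse] at he
    exact he.elim (hpe e) (hqe e)

/-- In a graph of large girth every edge inside a part is a tree edge. -/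
theorem eq_parent_of_adj (hg : ((4 * r + 3 : ℕ) : ℕ∞) ≤ G.egirth) {x y : V} (hadj : G.Adj x y)
    (h : P.root x = P.root y) : x ∉ M ∧ y = P.parent x ∨ y ∉ M ∧ x = P.parent y := by
  by_contra hcon
  obtain ⟨p, hp, hpe⟩ := P.exists_walk_of_root_eq h.symm
  -- A non-tree edge would close a cycle of length at most `2r + 1`.
  have hle := hg.trans (hadj.egirth_le p fun he => by
    obtain ⟨z, hz, hze⟩ := hpe _ he
    rcases Sym2.eq_iff.1 hze with ⟨rfl, rfl⟩ | ⟨rfl, rfl⟩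
    · exact hcon (Or.inl ⟨hz, rfl⟩)
    · exact hcon (Or.inr ⟨hz, rfl⟩))
  have : 4 * r + 3 ≤ p.length + 1 := by exact_mod_cast hle
  omega

/-- In a graph of large girth there is at most one edge between two parts. -/
theorem eq_of_adj_of_adj (hg : ((4 * r + 3 : ℕ) : ℕ∞) ≤ G.egirth) {x y x' y' : V}
    (hadj : G.Adj x y) (hadj' : G.Adj x' y') (hne : P.root x ≠ P.root y)
    (hx : P.root x = P.root x') (hy : P.root y = P.root y') : x = x' ∧ y = y' := by
  by_contra hcon
  obtain ⟨p, hp, hpe⟩ := P.exists_walk_of_root_eq hy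
  obtain ⟨q, hq, hqe⟩ := P.exists_walk_of_root_eq hx.symm
  have htree : ∀ z ∉ M, s(x, y) ≠ s(z, P.parent z) := by
    intro z hz he
    rcases Sym2.eq_iff.1 he with ⟨rfl, rfl⟩ | ⟨rfl, rfl⟩
    · exact hne (P.root_parent _ hz).symm
    · exact hne (P.root_parent _ hz)
  -- Two tree walks of length at most `2r` and the two cross edges give length at most `4r + 2`;
  -- this is where `4r + 3` is needed.
  have hle := hg.trans (hadj.egirth_le (p.append (SimpleGraph.Walk.cons hadj'.symm q))
    fun he => by
      simp only [SimpleGraph.Walk.edges_append, SimpleGraph.Walk.edges_cons, List.mem_append,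
        List.mem_cons] at he
      rcases he with he | he | he
      · obtain ⟨z, hz, hze⟩ := hpe _ he
        exact htree z hz hze
      · rcases Sym2.eq_iff.1 he with ⟨rfl, rfl⟩ | ⟨rfl, rfl⟩
        · exact hne hy.symm
        · exact hcon ⟨rfl, rfl⟩
      · obtain ⟨z, hz, hze⟩ := hqe _ he
        exact htree z hz hze)
  have : 4 * r + 3 ≤ (p.append (SimpleGraph.Walk.cons hadj'.symm q)).length + 1 := by
    exact_mod_cast hle
  simp only [SimpleGraph.Walk.length_append, SimpleGraph.Walk.length_cons] at this
  omega

end RootedPartition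

/-! ### The contraction as a shallow minor -/

namespace RootedPartition

variable {V : Type u} {G : SimpleGraph V} {r : ℕ} {M : Finset V} (P : RootedPartition G r M)

/-- The index of the part of a vertex. -/
noncomputable def partIndex (v : V) : Fin M.card :=
  M.equivFin ⟨P.root v, P.root_mem v⟩

theorem partIndex_eq_iff {v w : V} : P.partIndex v = P.partIndex w ↔ P.root v = P.root w := by
  simp [partIndex]

/-- The graph that arises by contracting every part. -/
def contraction : SimpleGraph (Fin M.card) where
  Adj i j := i ≠ j ∧ ∃ x y, P.partIndex x = i ∧ P.partIndex y = j ∧ G.Adj x y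
  symm := ⟨fun _ _ ⟨h, x, y, hx, hy, hxy⟩ => ⟨h.symm, y, x, hy, hx, hxy.symm⟩⟩
  loopless := ⟨fun _ h => h.1 rfl⟩

/-- A part, as a set of vertices of the whole graph as a subgraph of itself. -/
abbrev part (i : Fin M.card) : Set (⊤ : G.Subgraph).verts :=
  {x | P.partIndex x = i}

theorem edist_root_le (i : Fin M.card) (v m : P.part i)
    (hm : P.root v = m) :
    ((⊤ : G.Subgraph).coe.induce (P.part i)).edist m v ≤ (P.depth v : ℕ∞) := by
  suffices h : ∀ n (v : P.part i), P.root v = m →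
      P.depth v = n →
      ((⊤ : G.Subgraph).coe.induce (P.part i)).edist m v ≤ (n : ℕ∞) from
    h _ v hm rfl
  intro n
  induction n with
  | zero =>
    intro v hv hn
    have hvM : (v : V) ∈ M := by
      by_contra h
      have := P.depth_parent v h
      omega
    have : m = v := Subtype.ext (Subtype.ext (by rw [← hv, P.root_eq _ hvM]))
    simp [this]
  | succ n ih =>
    intro v hv hn
    have hvM : (v : V) ∉ M := fun h => by simp [P.depth_root _ h] at hn
    have hroot := P.root_parent _ hvM
    let w : P.part i :=
      ⟨⟨P.parent v, by simp⟩, (P.partIndex_eq_iff.2 hroot).trans v.2⟩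
    have hadj : ((⊤ : G.Subgraph).coe.induce (P.part i)).Adj w v := by
      simpa [w] using (P.adj_parent _ hvM).symm
    refine (SimpleGraph.edist_triangle (v := w)).trans ?_
    rw [SimpleGraph.edist_eq_one_iff_adj.2 hadj]
    push_cast
    gcongr
    exact ih w (hroot.trans hv) (by have := P.depth_parent _ hvM; simp only [w]; omega)

theorem isShallowMinor_contraction : IsShallowMinor r P.contraction G := by
  refine ⟨⊤, fun x => P.partIndex x, fun i => ?_, fun i j => ?_⟩
  · obtain ⟨⟨m, hm⟩, rfl⟩ := M.equivFin.surjective i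
    have hmi : P.partIndex m = M.equivFin ⟨m, hm⟩ := by simp [partIndex, P.root_eq m hm]
    let c : P.part (M.equivFin ⟨m, hm⟩) :=
      ⟨⟨m, by simp⟩, hmi⟩
    have hd (v) : ((⊤ : G.Subgraph).coe.induce
        (P.part (M.equivFin ⟨m, hm⟩))).edist c v ≤ (r : ℕ∞) := by
      refine (P.edist_root_le _ v c ?_).trans (by exact_mod_cast P.depth_le v)
      rw [P.partIndex_eq_iff.1 (v.2.trans hmi.symm), P.root_eq m hm]
    have hreach (v) := SimpleGraph.edist_ne_top_iff_reachable.1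
      (ne_top_of_le_ne_top (ENat.natCast_ne_top r) (hd v))
    refine ⟨SimpleGraph.connected_iff_exists_forall_reachable _ |>.2 ⟨c, hreach⟩, ?_⟩
    exact (iInf_le _ c).trans (iSup_le hd)
  · simp [contraction]

theorem card_edgeSet_contraction_le {k : ℕ} (hk : nabla r G ≤ (k : ℝ≥0∞)) :
    P.contraction.edgeSet.ncard ≤ k * M.card := by
  have h : edgeDensity P.contraction ≤ (k : ℝ≥0∞) :=
    le_trans (le_iSup_of_le M.card (le_iSup₂_of_le
      (f := fun (H : SimpleGraph (Fin M.card)) (_ : IsShallowMinor r H G) => edgeDensity H)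
      P.contraction P.isShallowMinor_contraction le_rfl)) hk
  rcases Nat.eq_zero_or_pos M.card with h0 | h0
  · have : IsEmpty (Fin M.card) := by rw [h0]; infer_instance
    have : P.contraction.edgeSet = ∅ := by
      rw [SimpleGraph.edgeSet_eq_empty]
      exact Subsingleton.elim _ _
    simp [this]
  · rw [edgeDensity, ENNReal.div_le_iff (by simpa using h0.ne') (by simp)] at h
    exact_mod_cast h

/-! ### Counting the survivors -/

variable [Fintype V]

open Classical in
/-- The ordered pairs of adjacent vertices in different parts. -/
noncomputable def crossPairs : Finset (V × V) :=
  Finset.univ.filter (fun q => G.Adj q.1 q.2 ∧ P.root q.1 ≠ P.root q.2)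

theorem mem_crossPairs {x y : V} :
    (x, y) ∈ P.crossPairs ↔ G.Adj x y ∧ P.root x ≠ P.root y := by
  simp [crossPairs]

/-- Since two parts share at most one edge, cross pairs inject into the darts of the contraction,
which number twice its edges. -/
theorem card_crossPairs_le (hg : ((4 * r + 3 : ℕ) : ℕ∞) ≤ G.egirth) {k : ℕ}
    (hk : nabla r G ≤ (k : ℝ≥0∞)) : P.crossPairs.card ≤ 2 * (k * M.card) := by
  classical
  have hdart : P.crossPairs.card ≤ Fintype.card P.contraction.Dart := by
    rw [← Finset.card_attach, ← Finset.card_univ]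
    refine Finset.card_le_card_of_injOn (fun q => ⟨(P.partIndex q.1.1, P.partIndex q.1.2), ?_⟩)
      (by simp) ?_
    · obtain ⟨h, hne⟩ := P.mem_crossPairs.1 q.2
      exact ⟨fun h' => hne (P.partIndex_eq_iff.1 h'), _, _, rfl, rfl, h⟩
    · rintro ⟨⟨x, y⟩, hq⟩ - ⟨⟨x', y'⟩, hq'⟩ - he
      obtain ⟨h, hne⟩ := P.mem_crossPairs.1 hq
      obtain ⟨h', -⟩ := P.mem_crossPairs.1 hq'
      simp only [SimpleGraph.Dart.mk.injEq, Prod.mk.injEq, P.partIndex_eq_iff] at he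
      obtain ⟨rfl, rfl⟩ := P.eq_of_adj_of_adj hg h h' hne he.1 he.2
      rfl
  rw [SimpleGraph.dart_card_eq_twice_card_edges] at hdart
  have := P.card_edgeSet_contraction_le hk
  rw [← SimpleGraph.coe_edgeFinset, Set.ncard_coe_finset] at this
  omega

/-- A survivor that is no root has a surviving neighbour only if it is an ancestor of an end of an
edge between different parts. -/
theorem exists_crossPair_of_mem_survivors {ident : V → ℕ}
    (hg : ((4 * r + 3 : ℕ) : ℕ∞) ≤ G.egirth) {v : V} (hvM : v ∉ M)
    (hv : v ∈ survivors G ident r) (hne : neighborsIn G (survivors G ident r) v ≠ ∅) :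
    ∃ q ∈ P.crossPairs, ∃ i < r, P.parent^[i] q.1 = v := by
  suffices h : ∀ n v, v ∉ M → r - P.depth v = n →
      (∃ q ∈ P.crossPairs, ∃ i, i + P.depth v = P.depth q.1 ∧ P.parent^[i] q.1 = v) ∨
      -- Height `n = r - depth v` bounds how deep the branch below `v` can reach, so `n + 1` steps
      -- suffice. As `v` is not a root, `n + 1 ≤ r`.
      (v ∈ survivors G ident (n + 1) → neighborsIn G (survivors G ident (n + 1)) v = ∅) by
    have hpos := P.depth_parent v hvM
    have hle := P.depth_le v
    rcases h _ v hvM rfl with ⟨q, hq, i, hi, hiv⟩ | h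
    · exact ⟨q, hq, i, by have := P.depth_le q.1; omega, hiv⟩
    · have hanti := survivors_anti (G := G) (ident := ident)
        (show r - P.depth v + 1 ≤ r by omega)
      exact absurd (Finset.subset_empty.1
        ((neighborsIn_mono hanti v).trans (h (hanti hv)).subset)) hne
  clear hne hv hvM v
  intro n
  induction n using Nat.strong_induction_on with
  | _ n ih =>
  intro v hvM hn
  refine or_iff_not_imp_left.2 fun hcross hv => ?_
  have hn' : n ≤ n + 1 := Nat.le_succ n
  have hsub : survivors G ident (n + 1) ⊆ survivors G ident n := survivors_anti hn'
  -- With no cross edge at or below `v`, its neighbours are its parent and its children; by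
  -- induction a child surviving `n` steps is isolated, which adjacency to `v` forbids.
  have hparent : neighborsIn G (survivors G ident n) v ⊆ {P.parent v} := by
    intro w hw
    obtain ⟨hwS, hadj⟩ := mem_neighborsIn.1 hw
    have hroot : P.root v = P.root w := by
      by_contra h
      exact hcross ⟨_, P.mem_crossPairs.2 ⟨hadj, h⟩, 0, by simp, rfl⟩
    rcases P.eq_parent_of_adj hg hadj hroot with ⟨-, rfl⟩ | ⟨hwM, rfl⟩
    · exact Finset.mem_singleton_self _
    · have hd := P.depth_parent w hwM
      have hr := P.depth_le w
      rcases ih (n - 1) (by omega) w hwM (by omega) with ⟨q, hq, i, hi, hiw⟩ | h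
      · refine absurd ⟨q, hq, i + 1, by omega, ?_⟩ hcross
        rw [Function.iterate_succ_apply', hiw]
      · rw [show n - 1 + 1 = n by omega] at h
        exact absurd (mem_neighborsIn.2 ⟨hsub hv, hadj.symm⟩) (by simp [h hwS])
  rcases Finset.subset_singleton_iff.1 hparent with h | h
  · exact Finset.subset_empty.1 ((neighborsIn_mono hsub v).trans h.subset)
  · obtain ⟨hpv, hlt⟩ := (mem_survivors_succ.1 hv).2 _ h
    refine Finset.eq_empty_of_forall_notMem fun w hw => ?_
    have hwp := Finset.mem_singleton.1 (hparent (neighborsIn_mono hsub v hw))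
    obtain ⟨-, hlt'⟩ := (mem_survivors_succ.1 (hwp ▸ (mem_neighborsIn.1 hw).1)).2 _ hpv
    exact lt_asymm hlt hlt'

theorem card_survivors_le (P : RootedPartition G r M) {ident : V → ℕ} (hg : ((4 * r + 3 : ℕ) : ℕ∞) ≤ G.egirth) {k : ℕ}
    (hk : nabla r G ≤ (k : ℝ≥0∞)) :
    (survivors G ident r).card ≤ (1 + 2 * (r * k)) * M.card := by
  classical
  let I := (survivors G ident r).filter
    (fun v => v ∈ M ∨ neighborsIn G (survivors G ident r) v = ∅)
  have hI : I.card ≤ M.card := by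
    refine Finset.card_le_card_of_injOn P.root (fun v _ => P.root_mem v) ?_
    intro v hv w hw h
    obtain ⟨hv, hv'⟩ := Finset.mem_filter.1 hv
    obtain ⟨hw, hw'⟩ := Finset.mem_filter.1 hw
    -- Equal roots put both vertices in one component, where an isolated survivor is unique.
    obtain ⟨p, -⟩ := P.exists_walk_of_root_eq h
    rcases hv' with hvM | hv'
    · rcases hw' with hwM | hw'
      · rwa [P.root_eq v hvM, P.root_eq w hwM] at h
      · exact eq_of_neighborsIn_eq_empty hw hw' hv p.reverse.reachable
    · exact (eq_of_neighborsIn_eq_empty hv hv' hw p.reachable).symm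
  have hsub : survivors G ident r ⊆
      I ∪ (P.crossPairs ×ˢ Finset.range r).image (fun q => P.parent^[q.2] q.1.1) := by
    intro v hv
    by_cases hvI : v ∈ M ∨ neighborsIn G (survivors G ident r) v = ∅
    · exact Finset.mem_union_left _ (Finset.mem_filter.2 ⟨hv, hvI⟩)
    · obtain ⟨hvM, hne⟩ := not_or.1 hvI
      obtain ⟨q, hq, i, hi, hiv⟩ := P.exists_crossPair_of_mem_survivors hg hvM hv hne
      exact Finset.mem_union_right _ (Finset.mem_image.2
        ⟨(q, i), Finset.mem_product.2 ⟨hq, Finset.mem_range.2 hi⟩, hiv⟩)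
  calc (survivors G ident r).card
      ≤ I.card + (P.crossPairs ×ˢ Finset.range r).card :=
        (Finset.card_le_card hsub).trans ((Finset.card_union_le _ _).trans
          (Nat.add_le_add_left Finset.card_image_le _))
    _ ≤ M.card + 2 * (k * M.card) * r := by
        rw [Finset.card_product, Finset.card_range]
        gcongr
        exact P.card_crossPairs_le hg hk
    _ = (1 + 2 * (r * k)) * M.card := by ring

end RootedPartition

/-! ### The distributed algorithm -/

/-- The local memory of a vertex in distributed leaf pruning. -/
structure PruningState where
  /-- the number of rounds so far -/
  clock : ℕ
  /-- the own identifier -/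
  id : ℕ
  /-- whether the vertex has survived so far -/
  alive : Bool
  /-- the identifiers of the neighbours that were alive when last heard of -/
  nbrs : Finset ℕ

open Classical in
/-- Leaf pruning with `r` steps of two rounds each: in the first round of a step every vertex
announces whether it is alive, in the second whether it has exactly one neighbour alive. -/
noncomputable def leafPruning (r : ℕ) : DistributedAlgorithm where
  State := PruningState
  init i _ := ⟨0, i, true, ∅⟩
  send s _ := if Even s.clock then [s.alive] else [decide (s.nbrs.card = 1)]
  receive s R :=
    if Even s.clock then
      { s with clock := s.clock + 1, nbrs := (R.filter (fun q => q.2 = [true])).image Prod.fst }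
    else
      { s with
        clock := s.clock + 1
        alive := s.alive &&
          decide (s.nbrs.card = 1 → ∃ j ∈ s.nbrs, j < s.id ∧ (j, [true]) ∈ R) }
  output s := if s.clock = 2 * r then some s.alive else none

/-! ### Two rounds simulate one pruning step -/

section Correctness

variable {V : Type u} [Fintype V] {G : SimpleGraph V} {ident : V → ℕ} {r : ℕ}

open Classical in
theorem leafPruning_state_odd {t : ℕ} (ht : t < r)
    (h : ∀ v, ∃ B, (leafPruning r).state G ident (2 * t) v =
      (⟨2 * t, ident v, decide (v ∈ survivors G ident t), B⟩ : PruningState)) (v : V) :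
    (leafPruning r).state G ident (2 * t + 1) v =
      (⟨2 * t + 1, ident v, decide (v ∈ survivors G ident t),
        (neighborsIn G (survivors G ident t) v).image ident⟩ : PruningState) := by
  choose B hB using h
  have h1 : 2 * t ≠ 2 * r := by omega
  simp only [DistributedAlgorithm.state, DistributedAlgorithm.outgoing, hB]
  simp only [leafPruning, h1, if_false, Option.isSome_none, Bool.false_eq_true, even_two_mul,
    if_true, PruningState.mk.injEq, true_and]
  ext i
  simp only [Finset.mem_image, Finset.mem_filter, mem_neighborsIn, Finset.mem_univ, true_and,
    Prod.exists]
  constructor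
  · rintro ⟨_, _, ⟨⟨u, hu, he⟩, h⟩, rfl⟩
    obtain ⟨rfl, rfl⟩ := Prod.mk.inj he
    exact ⟨u, ⟨by simpa using h, hu⟩, rfl⟩
  · rintro ⟨u, ⟨hu, hadj⟩, rfl⟩
    exact ⟨_, _, ⟨⟨u, hadj, rfl⟩, by simp [hu]⟩, rfl⟩

-- The stored neighbour set is left arbitrary because the next announcement round overwrites it.
open Classical in
theorem leafPruning_state_even (hinj : Function.Injective ident) {t : ℕ} (ht : t ≤ r) (v : V) :
    ∃ B, (leafPruning r).state G ident (2 * t) v =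
      (⟨2 * t, ident v, decide (v ∈ survivors G ident t), B⟩ : PruningState) := by
  induction t generalizing v with
  | zero => exact ⟨∅, by simp [DistributedAlgorithm.state, leafPruning, survivors]⟩
  | succ t ih =>
    have hodd := leafPruning_state_odd ht (ih (by omega))
    have h1 : 2 * t + 1 ≠ 2 * r := by omega
    have h2 : ¬ Even (2 * t + 1) := by simp
    refine ⟨(neighborsIn G (survivors G ident t) v).image ident, ?_⟩
    rw [show 2 * (t + 1) = 2 * t + 1 + 1 by ring]
    rw [DistributedAlgorithm.state]
    simp only [DistributedAlgorithm.outgoing, hodd]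
    simp only [leafPruning, h1, h2, if_false, Option.isSome_none, Bool.false_eq_true,
      PruningState.mk.injEq, true_and, and_true, Finset.card_image_of_injective _ hinj]
    rw [← Bool.decide_and, decide_eq_decide, mem_survivors_succ]
    refine and_congr_right fun hv => ⟨fun h u hu => ?_, fun h hcard => ?_⟩
    · obtain ⟨j, hj, hlt, hjR⟩ := h (by simp [hu])
      simp only [hu, Finset.image_singleton, Finset.mem_singleton] at hj
      subst hj
      obtain ⟨w, hw, he⟩ := Finset.mem_image.1 hjR
      obtain ⟨hwu, hd⟩ := Prod.mk.inj he
      obtain rfl := hinj hwu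
      refine ⟨?_, hlt⟩
      -- The one-bit message says only that `w` has a single live neighbour; as `v` is live and
      -- adjacent, that neighbour is `v`.
      have hvN : v ∈ neighborsIn G (survivors G ident t) w :=
        mem_neighborsIn.2 ⟨hv, (Finset.mem_filter.1 hw).2.symm⟩
      obtain ⟨x, hx⟩ := Finset.card_eq_one.1 (by simpa using hd)
      rw [hx] at hvN ⊢
      rw [Finset.mem_singleton.1 hvN]
    · obtain ⟨u, hu⟩ := Finset.card_eq_one.1 hcard
      obtain ⟨huv, hlt⟩ := h u hu
      refine ⟨ident u, by simp [hu], hlt, Finset.mem_image.2 ⟨u, ?_, by simp [huv]⟩⟩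
      exact Finset.mem_filter.2 ⟨Finset.mem_univ _, (adj_of_neighborsIn_eq hu).2⟩

theorem leafPruning_haltsWithin (hinj : Function.Injective ident) :
    (leafPruning r).HaltsWithin G ident (2 * r) := by
  intro v
  obtain ⟨B, hB⟩ := leafPruning_state_even (G := G) hinj (le_refl r) v
  rw [hB]
  simp [leafPruning]

theorem leafPruning_outputSet (hinj : Function.Injective ident) :
    (leafPruning r).outputSet G ident (2 * r) = survivors G ident r := by
  ext v
  obtain ⟨B, hB⟩ := leafPruning_state_even (G := G) hinj (le_refl r) v
  rw [DistributedAlgorithm.outputSet, Finset.mem_filter, hB]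
  simp [leafPruning]

theorem leafPruning_messagesBoundedBy {B : ℕ} (hB : 1 ≤ B) :
    (leafPruning r).MessagesBoundedBy G ident B := by
  intro t u v _
  refine le_trans ?_ hB
  simp only [DistributedAlgorithm.outgoing, leafPruning]
  split_ifs <;> simp

end Correctness

/-- `A r` is the algorithm for distance parameter `r`: it, the constants `cRounds` and `cApprox`,
and the message constant `cBits a`, depend neither on the class, nor on its expansion function, nor
on the graph; the constants do not depend on `r` either. The constant `a` bounds the length of
the identifiers. -/
theorem theorem1 :
    ∃ (A : ℕ → DistributedAlgorithm) (cRounds cApprox : ℕ) (cBits : ℕ → ℕ),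
      ∀ (r : ℕ) (f : ℕ → ℕ) (C : GraphClass.{u}),
        C.HasExpansion f → C.GirthAtLeast (4 * r + 3) →
        ∀ (V : Type u) [Fintype V] (G : SimpleGraph V), C V G →
        ∀ (a : ℕ) (ident : V → ℕ), IsIdentifierAssignment a ident →
          (A r).MessagesBoundedBy G ident (cBits a * (Nat.log 2 (Fintype.card V) + 1)) ∧
          (A r).HaltsWithin G ident (cRounds * r) ∧
          IsDistDominatingApprox G r (1 + cApprox * (r * f r))
            ((A r).outputSet G ident (cRounds * r)) := by
  -- Two rounds per step, two orientations per cross edge, and one bit per message.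
  refine ⟨leafPruning, 2, 2, fun _ => 1, fun r f C hC hg V _ G hG a ident hid =>
    ⟨leafPruning_messagesBoundedBy (by simp), leafPruning_haltsWithin hid.1, ?_⟩⟩
  rw [leafPruning_outputSet hid.1]
  refine ⟨isDistDominating_survivors hid.1 r, fun M hM => ?_⟩
  obtain ⟨P⟩ := hM.nonempty_rootedPartition
  exact P.card_survivors_le (hg V G hG) (hC V G hG r)
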